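/- Let $m\ge 1$, let $(\mathbb P,\sigma)$ be a connected smooth Riemannian manifold of dimension $m$ (without boundary), let $I\subseteq\mathbb R$ be a nonempty open interval, and let $h\in C^\infty(\mathbb P)$ and $\rho\in C^\infty(I)$ be positive functions. Let $\overline M=I\times\mathbb P$ be the doubly warped product spacetime with the Lorentzian metric $$\overline g_{(t,x)}=-h(x)^2\,\pi_I^*(dt^2)+\rho(t)^2\,\pi_{\mathbb P}^*(\sigma),$$ where $\pi_I,\pi_{\mathbb P}$ are the projections, time-oriented by $\partial_t$, and put $$\mathcal H(t,x)=\frac{\rho'(t)}{h(x)\rho(t)} .$$ Let $\psi:M\to\overline M$ be a spacelike hypersurface, that is, $M$ is a smooth $m$-dimensional manifold without boundary and $\psi$ is a smooth map for which $g=\psi^*\overline g$ is a Riemannian metric on $M$. Let $N$ be the future-pointing unit normal of $\psi$, i.e. the vector field along $\psi$ orthogonal to $\psi$ with $\overline g(N,N)=-1$ and $\overline g(N,\partial_t)<0$. Let $\overline\nabla,\nabla$ be the Levi-Civita connections of $\overline g,g$, let $\mathrm{II}(V,W)=\overline\nabla_VW-\nabla_VW$ be the second fundamental form of $\psi$, let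 $\mathbf H=\frac1m\operatorname{trace}_g\mathrm{II}$ be its mean curvature vector, and let $H=-\overline g(\mathbf H,N)$ be its mean curvature function. Let $\tau=\pi_I\circ\psi:M\to I$ be the height function of $\psi$. If $\tau$ attains a local minimum at $p_0\in M$, then $\mathcal H(\psi(p_0))\le H(p_0)$. If $\tau$ attains a local maximum at $p^0\in M$, then $\mathcal H(\psi(p^0))\ge H(p^0)$. -/

import Mathlib

open scoped Manifold ContDiff

noncomputable section

/-! ### Semi-Riemannian metrics and their Levi-Civita connections in charts

All manifolds below are without boundary (`I` and `J` are only used for boundaryless models). -/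

section LeviCivita

variable {E : Type*} [NormedAddCommGroup E] [NormedSpace ℝ E]
  {H : Type*} [TopologicalSpace H] {I : ModelWithCorners ℝ E H}
  {X : Type*} [TopologicalSpace X] [ChartedSpace H X]

/-- The component expression `y ↦ G(y)`, in the preferred chart at `x₀`, of a field `g` of bilinear
forms on the tangent spaces of `X`: `G(y)(v, w) = g(dκ⁻¹ v, dκ⁻¹ w)` with `κ = extChartAt I x₀`.
In the standard basis its entries are the usual `g_{ab}(y)`. -/
def metricInChart (g : ∀ x : X, TangentSpace I x →L[ℝ] TangentSpace I x →L[ℝ] ℝ)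
    (x₀ : X) (y : E) : E →L[ℝ] E →L[ℝ] ℝ :=
  let G : E →L[ℝ] E →L[ℝ] ℝ := g ((extChartAt I x₀).symm y)
  let A : E →L[ℝ] E := mfderiv 𝓘(ℝ, E) I (extChartAt I x₀).symm y
  G.bilinearComp A A

/-- The Christoffel symbols of the first kind at `x₀` in the preferred chart at `x₀`: the covector
`z ↦ ½ (∂_v G(w, z) + ∂_w G(v, z) - ∂_z G(v, w))`. -/
def christoffelLower (g : ∀ x : X, TangentSpace I x →L[ℝ] TangentSpace I x →L[ℝ] ℝ)
    (x₀ : X) (v w : E) : E →L[ℝ] ℝ :=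
  let dG : E →L[ℝ] E →L[ℝ] E →L[ℝ] ℝ := fderiv ℝ (metricInChart g x₀) (extChartAt I x₀ x₀)
  (1 / 2 : ℝ) • (dG v w + dG w v - (dG.flip v).flip w)

/-- The Christoffel symbols of the Levi-Civita connection of the (nondegenerate, symmetric) metric
`g` at `x₀`, in the preferred chart at `x₀`: `Γ(v, w) = Γ^c_{ab} v^a w^b ∂_c`, the vector which
represents `christoffelLower g x₀ v w` with respect to the metric. Thus, in this chart,
`∇_V W = D W (V) + Γ(V, W)` at `x₀`. -/
def christoffel (g : ∀ x : X, TangentSpace I x →L[ℝ] TangentSpace I x →L[ℝ] ℝ)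
    (x₀ : X) (v w : E) : E :=
  (metricInChart g x₀ (extChartAt I x₀ x₀)).inverse (christoffelLower g x₀ v w)

end LeviCivita

/-! ### Extrinsic geometry of immersions -/

section Immersion

variable {E : Type*} [NormedAddCommGroup E] [NormedSpace ℝ E]
  {H : Type*} [TopologicalSpace H] {I : ModelWithCorners ℝ E H}
  {M : Type*} [TopologicalSpace M] [ChartedSpace H M]
  {E' : Type*} [NormedAddCommGroup E'] [NormedSpace ℝ E']
  {H' : Type*} [TopologicalSpace H'] {J : ModelWithCorners ℝ E' H'}
  {X : Type*} [TopologicalSpace X] [ChartedSpace H' X]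

/-- The pullback `ψ^* g` to `M` of a field `g` of bilinear forms on `X`. -/
def pullbackMetric (I : ModelWithCorners ℝ E H)
    (g : ∀ x : X, TangentSpace J x →L[ℝ] TangentSpace J x →L[ℝ] ℝ) (ψ : M → X) (q : M) :
    TangentSpace I q →L[ℝ] TangentSpace I q →L[ℝ] ℝ :=
  let G : E' →L[ℝ] E' →L[ℝ] ℝ := g (ψ q)
  let A : E →L[ℝ] E' := mfderiv I J ψ q
  let B : E →L[ℝ] E →L[ℝ] ℝ := G.bilinearComp A A
  B

/-- The second fundamental form `II(v, w) = ∇̄_V W - ∇_V W` at `q` of an immersion `ψ : M → X`,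
where `∇̄` is the Levi-Civita connection of the metric `g` on `X` and `∇` that of the induced
metric `ψ^* g` on `M`. Both `∇̄_V W` and `∇_V W` are computed for the vector fields `V`, `W` with
constant components `v`, `w` in the preferred chart at `q`; with `ψ̂` the expression of `ψ` in
the preferred charts at `q` and `ψ q` one has `∇̄_V W = D²ψ̂(v, w) + Γ̄(Dψ̂ v, Dψ̂ w)` and
`∇_V W = Dψ̂ (Γ(v, w))`, viewed in `T_{ψ q} X`. -/
def secondFundamentalForm
    (g : ∀ x : X, TangentSpace J x →L[ℝ] TangentSpace J x →L[ℝ] ℝ) (ψ : M → X) (q : M)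
    (v w : TangentSpace I q) : TangentSpace J (ψ q) :=
  let ψhat : E → E' := writtenInExtChartAt I J q ψ
  let dψ : E →L[ℝ] E' := mfderiv I J ψ q
  (fderiv ℝ (fderiv ℝ ψhat) (extChartAt I q q) v w + christoffel g (ψ q) (dψ v) (dψ w))
    - dψ (christoffel (pullbackMetric I g ψ) q v w)

end Immersion

/-- The trace with respect to the inner product `g` of a bilinear map `B` on `ℝᵐ`, i.e.
`∑_{i,j} g^{ij} B(∂_i, ∂_j)` with `(g^{ij})` the inverse of the Gram matrix `(g(∂_i, ∂_j))` of the
standard basis. -/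
def metricTrace {m : ℕ} {F : Type*} [AddCommGroup F] [Module ℝ F]
    (g : EuclideanSpace ℝ (Fin m) →L[ℝ] EuclideanSpace ℝ (Fin m) →L[ℝ] ℝ)
    (B : EuclideanSpace ℝ (Fin m) → EuclideanSpace ℝ (Fin m) → F) : F :=
  let b := EuclideanSpace.basisFun (Fin m) ℝ
  ∑ i, ∑ j, (Matrix.of fun k l => g (b k) (b l))⁻¹ i j • B (b i) (b j)

/-- `metricTrace` is the usual trace: it equals `∑ᵢ B(eᵢ, eᵢ)` for every `g`-orthonormal basis. -/
theorem metricTrace_eq_sum {m : ℕ} {F : Type*} [AddCommGroup F] [Module ℝ F]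
    (g : EuclideanSpace ℝ (Fin m) →L[ℝ] EuclideanSpace ℝ (Fin m) →L[ℝ] ℝ)
    (B : EuclideanSpace ℝ (Fin m) →ₗ[ℝ] EuclideanSpace ℝ (Fin m) →ₗ[ℝ] F)
    (e : Fin m → EuclideanSpace ℝ (Fin m)) (he : ∀ i j, g (e i) (e j) = if i = j then 1 else 0) :
    metricTrace g (fun v w => B v w) = ∑ i, B (e i) (e i) := by
  set b := EuclideanSpace.basisFun (Fin m) ℝ with hb
  let A : Matrix (Fin m) (Fin m) ℝ := Matrix.of fun k i => e i k
  let G : Matrix (Fin m) (Fin m) ℝ := Matrix.of fun k l => g (b k) (b l)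
  have hexp : ∀ i, e i = ∑ k, A k i • b k := by
    intro i
    simpa [A, hb] using (b.sum_repr (e i)).symm
  have h1 : A.transpose * (G * A) = 1 := by
    ext i j
    have := he i j
    rw [hexp i, hexp j] at this
    simp only [map_sum, map_smul, sum_apply, smul_apply,
      smul_eq_mul] at this
    simp only [Matrix.mul_apply, Matrix.transpose_apply, Matrix.one_apply]
    rw [← this]
    simp only [Finset.mul_sum]
    rw [Finset.sum_comm]
    refine Finset.sum_congr rfl fun k _ => Finset.sum_congr rfl fun l _ => ?_
    simp only [G, Matrix.of_apply]
    ring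
  have h2 : G⁻¹ = A * A.transpose := by
    apply Matrix.inv_eq_right_inv
    have h3 : (G * A) * A.transpose = 1 := mul_eq_one_comm.mp h1
    rwa [Matrix.mul_assoc] at h3
  have h4 : ∀ i, B (e i) (e i) = ∑ k, ∑ l, (A k i * A l i) • B (b k) (b l) := by
    intro i
    conv_lhs => rw [hexp i]
    simp only [map_sum, map_smul, LinearMap.sum_apply, LinearMap.smul_apply, Finset.smul_sum,
      smul_smul]
    rw [Finset.sum_comm]
    refine Finset.sum_congr rfl fun k _ => Finset.sum_congr rfl fun l _ => ?_
    rw [mul_comm]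
  simp only [h4]
  rw [Finset.sum_comm]
  change ∑ k, ∑ l, G⁻¹ k l • B (b k) (b l) = _
  refine Finset.sum_congr rfl fun k _ => ?_
  rw [Finset.sum_comm]
  refine Finset.sum_congr rfl fun l _ => ?_
  rw [h2, Matrix.mul_apply, Finset.sum_smul]
  rfl

section MeanCurvature

variable {M : Type*} [TopologicalSpace M]
  {E' : Type*} [NormedAddCommGroup E'] [NormedSpace ℝ E']
  {H' : Type*} [TopologicalSpace H'] {J : ModelWithCorners ℝ E' H'}
  {X : Type*} [TopologicalSpace X] [ChartedSpace H' X]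

/-- The mean curvature vector `𝐇 = (1/m) trace_g II` of an immersion `ψ` of an `m`-manifold, with
`g` the induced metric. -/
def meanCurvatureVector (m : ℕ) [ChartedSpace (EuclideanSpace ℝ (Fin m)) M]
    (g : ∀ x : X, TangentSpace J x →L[ℝ] TangentSpace J x →L[ℝ] ℝ) (ψ : M → X) (q : M) :
    TangentSpace J (ψ q) :=
  (1 / m : ℝ) • metricTrace (pullbackMetric (𝓡 m) g ψ q)
    (secondFundamentalForm (I := 𝓡 m) g ψ q)

/-- The mean curvature function `H = -g(𝐇, N)` with respect to the timelike unit normal `N`. -/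
def meanCurvature (m : ℕ) [ChartedSpace (EuclideanSpace ℝ (Fin m)) M]
    (g : ∀ x : X, TangentSpace J x →L[ℝ] TangentSpace J x →L[ℝ] ℝ) (ψ : M → X)
    (N : ∀ q : M, TangentSpace J (ψ q)) (q : M) : ℝ :=
  -(g (ψ q) (meanCurvatureVector m g ψ q) (N q))

end MeanCurvature

/-! ### Doubly warped products -/

/-- The data of a doubly warped product spacetime `I ₕ×_ρ P`: an open interval `I`, a Riemannian
metric `σ` on the `m`-manifold `P` and positive smooth functions `h` on `P` and `ρ` on `I`.
The spacetime is the open submanifold `{p | p.1 ∈ I}` of `ℝ × P`; values of `ρ` outside `I`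
are irrelevant. -/
structure DoublyWarpedProduct (m : ℕ) (P : Type*) [TopologicalSpace P]
    [ChartedSpace (EuclideanSpace ℝ (Fin m)) P] [IsManifold (𝓡 m) ∞ P] where
  I : Set ℝ
  isOpen_I : IsOpen I
  ordConnected_I : I.OrdConnected
  nonempty_I : I.Nonempty
  σ : Bundle.ContMDiffRiemannianMetric (𝓡 m) ∞ (EuclideanSpace ℝ (Fin m))
    (fun x : P => TangentSpace (𝓡 m) x)
  h : P → ℝ
  contMDiff_h : ContMDiff (𝓡 m) 𝓘(ℝ, ℝ) ∞ h
  h_pos : ∀ x, 0 < h x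
  ρ : ℝ → ℝ
  contDiffOn_ρ : ContDiffOn ℝ ∞ ρ I
  ρ_pos : ∀ t ∈ I, 0 < ρ t

namespace DoublyWarpedProduct

variable {m : ℕ} {P : Type*} [TopologicalSpace P] [ChartedSpace (EuclideanSpace ℝ (Fin m)) P]
  [IsManifold (𝓡 m) ∞ P] (W : DoublyWarpedProduct m P)

/-- The Lorentzian metric `-h(x)² π_I^*(dt²) + ρ(t)² π_P^*(σ)` at `(t, x)`. -/
def metric (p : ℝ × P) :
    TangentSpace (𝓘(ℝ, ℝ).prod (𝓡 m)) p →L[ℝ] TangentSpace (𝓘(ℝ, ℝ).prod (𝓡 m)) p →L[ℝ] ℝ :=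
  let α : ℝ × EuclideanSpace ℝ (Fin m) →L[ℝ] ℝ :=
    mfderiv (𝓘(ℝ, ℝ).prod (𝓡 m)) 𝓘(ℝ, ℝ) (Prod.fst : ℝ × P → ℝ) p
  let β : ℝ × EuclideanSpace ℝ (Fin m) →L[ℝ] EuclideanSpace ℝ (Fin m) :=
    mfderiv (𝓘(ℝ, ℝ).prod (𝓡 m)) (𝓡 m) (Prod.snd : ℝ × P → P) p
  let s : EuclideanSpace ℝ (Fin m) →L[ℝ] EuclideanSpace ℝ (Fin m) →L[ℝ] ℝ := W.σ.inner p.2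
  let B : ℝ × EuclideanSpace ℝ (Fin m) →L[ℝ] ℝ × EuclideanSpace ℝ (Fin m) →L[ℝ] ℝ :=
    -(W.h p.2 ^ 2) • (ContinuousLinearMap.mul ℝ ℝ).bilinearComp α α
      + (W.ρ p.1 ^ 2) • s.bilinearComp β β
  B

/-- The coordinate vector field `∂_t`. -/
def timeField (p : ℝ × P) : TangentSpace (𝓘(ℝ, ℝ).prod (𝓡 m)) p :=
  ((1, 0) : ℝ × EuclideanSpace ℝ (Fin m))

/-- The function `𝓗(t, x) = ρ'(t) / (h(x) ρ(t))`, the mean curvature of the slice `{t} × P`. -/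
def sliceCurvature (p : ℝ × P) : ℝ :=
  deriv W.ρ p.1 / (W.h p.2 * W.ρ p.1)

variable {M : Type*} [TopologicalSpace M] [ChartedSpace (EuclideanSpace ℝ (Fin m)) M]

/-- `ψ : M → I ₕ×_ρ P` is a spacelike (immersed) hypersurface: it is smooth, takes its values in
`I × P`, and the induced metric is Riemannian (so that `ψ` is an immersion). -/
structure IsSpacelikeHypersurface (ψ : M → ℝ × P) : Prop where
  contMDiff : ContMDiff (𝓡 m) (𝓘(ℝ, ℝ).prod (𝓡 m)) ∞ ψ
  mem_I : ∀ q, (ψ q).1 ∈ W.I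
  posDef : ∀ (q : M) (v : TangentSpace (𝓡 m) q), v ≠ 0 → 0 < pullbackMetric (𝓡 m) W.metric ψ q v v

/-- `N` is the future-pointing unit normal of the spacelike hypersurface `ψ`. -/
structure IsFutureUnitNormal (ψ : M → ℝ × P)
    (N : ∀ q : M, TangentSpace (𝓘(ℝ, ℝ).prod (𝓡 m)) (ψ q)) : Prop where
  unit : ∀ q, W.metric (ψ q) (N q) (N q) = -1
  normal : ∀ (q : M) (v : TangentSpace (𝓡 m) q),
    W.metric (ψ q) (N q) (mfderiv (𝓡 m) (𝓘(ℝ, ℝ).prod (𝓡 m)) ψ q v) = 0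
  future : ∀ q, W.metric (ψ q) (N q) (timeField (ψ q)) < 0

end DoublyWarpedProduct

end

/-! At a critical point `q` of the height function `τ`, `dψ` takes values in the spatial directions;
it is injective because the induced metric is definite, so it fills them by dimension. Hence the
future unit normal there is `N = h⁻¹ ∂ₜ` (`normal_eq`), and pairing `II` with `-N` reads off time
components.

The intrinsic term of `II` is tangent and drops out. The second derivative of `ψ` contributes `h
D²τ(v, w)`. The ambient Christoffel term contributes `h⁻¹ ρ ρ' σ(v, w) = 𝓗 g(v, w)`, since among the
metric derivatives only `∂ₜ(ρ² σ)` enters its time component (`form_christoffel_time`). Taking the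
trace gives `H = 𝓗 + (h / m) tr_g D²τ` at `q` (`meanCurvature_eq`).

At a local extremum `D²τ` is semidefinite, and tracing with a positive definite `g` preserves the
sign (`metricTrace_nonneg`), which gives both inequalities. -/

noncomputable section

/-! ### Second-order conditions at extrema and nondegenerate forms -/

/-- The second order necessary condition for a local minimum. -/
theorem IsLocalMin.fderiv_fderiv_nonneg {E : Type*} [NormedAddCommGroup E] [NormedSpace ℝ E]
    {f : E → ℝ} {x : E} (hmin : IsLocalMin f x) (hf : ContDiffAt ℝ 2 f x) (v : E) :
    0 ≤ fderiv ℝ (fderiv ℝ f) x v v := by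
  let γ : ℝ → E := fun s => x + s • v
  have hγ0 : γ 0 = x := by simp [γ]
  have hγ : ∀ s, HasDerivAt γ v s := fun s => by
    simpa [γ] using ((hasDerivAt_id s).smul_const v).const_add x
  have hγc : Filter.Tendsto γ (nhds 0) (nhds x) := by
    simpa [hγ0] using (hγ 0).continuousAt.tendsto
  have hd1 : ∀ᶠ y in nhds x, DifferentiableAt ℝ f y := by
    filter_upwards [hf.eventually (by simp)] with y hy
    exact hy.differentiableAt (by simp)
  have hderiv : deriv (f ∘ γ) =ᶠ[nhds 0] fun s => fderiv ℝ f (γ s) v := by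
    filter_upwards [hγc.eventually hd1] with s hs
    exact (hs.hasFDerivAt.comp_hasDerivAt s (hγ s)).deriv
  have hd2 : DifferentiableAt ℝ (fderiv ℝ f) (γ 0) := by
    rw [hγ0]
    exact (hf.fderiv_right (m := 1) (by norm_num)).differentiableAt (by simp)
  have hderiv2 : deriv (deriv (f ∘ γ)) 0 = fderiv ℝ (fderiv ℝ f) x v v := by
    rw [hderiv.deriv_eq]
    have := (hd2.hasFDerivAt.comp_hasDerivAt 0 (hγ 0)).clm_apply (hasDerivAt_const 0 v)
    simpa [hγ0] using this.deriv
  have hmin' : IsLocalMin (f ∘ γ) 0 := by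
    have : ∀ᶠ s in nhds 0, f x ≤ f (γ s) := hγc.eventually hmin
    simpa [IsLocalMin, IsMinFilter, hγ0] using this
  -- A negative second derivative along the line would make `0` a local maximum as well as a local
  -- minimum. The restriction would then be locally constant and its second derivative zero.
  by_contra! hneg
  rw [← hderiv2] at hneg
  have hcont : ContinuousAt (f ∘ γ) 0 :=
    ContinuousAt.comp (by rw [hγ0]; exact hf.continuousAt) (hγ 0).continuousAt
  have hmax := isLocalMax_of_deriv_deriv_neg hneg hmin'.deriv_eq_zero hcont
  have hconst : f ∘ γ =ᶠ[nhds 0] fun _ => (f ∘ γ) 0 := by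
    filter_upwards [hmin', hmax] with s h1 h2 using le_antisymm h2 h1
  have h1 : deriv (f ∘ γ) =ᶠ[nhds 0] fun _ => 0 := by
    simpa using hconst.deriv
  rw [h1.deriv_eq] at hneg
  simp at hneg

/-- The second order necessary condition for a local maximum. -/
theorem IsLocalMax.fderiv_fderiv_nonpos {E : Type*} [NormedAddCommGroup E] [NormedSpace ℝ E]
    {f : E → ℝ} {x : E} (hmax : IsLocalMax f x) (hf : ContDiffAt ℝ 2 f x) (v : E) :
    fderiv ℝ (fderiv ℝ f) x v v ≤ 0 := by
  have h := hmax.neg.fderiv_fderiv_nonneg (f := fun y => -f y) (ContDiffAt.neg hf) v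
  have h1 : fderiv ℝ (fun y => -f y) = -fderiv ℝ f := by
    ext1 y
    simp
  rw [h1, fderiv_neg] at h
  simpa using h

/-- A nondegenerate bilinear form on a finite-dimensional space represents every covector. -/
theorem ContinuousLinearMap.apply_inverse_of_injective {E : Type*} [NormedAddCommGroup E]
    [NormedSpace ℝ E] [FiniteDimensional ℝ E] (G : E →L[ℝ] E →L[ℝ] ℝ)
    (hG : Function.Injective G) (l : E →L[ℝ] ℝ) : G (G.inverse l) = l := by
  have hdim : Module.finrank ℝ E = Module.finrank ℝ (E →L[ℝ] ℝ) := by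
    rw [← (LinearMap.toContinuousLinearMap (𝕜 := ℝ) (E := E) (F' := ℝ)).finrank_eq,
      Subspace.dual_finrank_eq]
  -- `inverse` has the default value `0` off the invertible maps, so `G` must be exhibited as an
  -- equivalence.
  let e : E ≃L[ℝ] (E →L[ℝ] ℝ) :=
    (LinearMap.linearEquivOfInjective (G : E →ₗ[ℝ] E →L[ℝ] ℝ) hG hdim).toContinuousLinearEquiv
  have he : G = (e : E →L[ℝ] E →L[ℝ] ℝ) := by
    ext1 v
    rfl
  rw [he, ContinuousLinearMap.inverse_equiv]
  exact e.apply_symm_apply l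

/-! ### Traces with respect to an inner product -/

section Trace

variable {m : ℕ} (g : EuclideanSpace ℝ (Fin m) →L[ℝ] EuclideanSpace ℝ (Fin m) →L[ℝ] ℝ)

/-- The quadratic form of the Gram matrix at `x` is `g(v, v)` with `v = ∑ x_k b_k`. This makes the
inverse matrix in `metricTrace` genuine and positive definite. -/
theorem posDef_gram (hsymm : ∀ v w, g v w = g w v) (hpos : ∀ v, v ≠ 0 → 0 < g v v) :
    (Matrix.of fun k l => g (EuclideanSpace.basisFun (Fin m) ℝ k)
      (EuclideanSpace.basisFun (Fin m) ℝ l)).PosDef := by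
  refine Matrix.PosDef.of_dotProduct_mulVec_pos ?_ fun {x} hx => ?_
  · ext i j
    simpa using hsymm _ _
  · set b := EuclideanSpace.basisFun (Fin m) ℝ
    have hv : WithLp.toLp 2 x = ∑ k, x k • b k := by
      simpa [b] using (b.sum_repr (WithLp.toLp 2 x)).symm
    have h := hpos (WithLp.toLp 2 x) (by simpa using hx)
    rw [hv] at h
    simp only [map_sum, map_smul, sum_apply, smul_apply, smul_eq_mul] at h
    refine h.trans_eq ?_
    simp only [dotProduct, Matrix.mulVec, Matrix.of_apply, star_trivial, Finset.mul_sum]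
    rw [Finset.sum_comm]
    refine Finset.sum_congr rfl fun k _ => Finset.sum_congr rfl fun l _ => ?_
    ring

theorem metricTrace_add {F : Type*} [AddCommGroup F] [Module ℝ F]
    (B C : EuclideanSpace ℝ (Fin m) → EuclideanSpace ℝ (Fin m) → F) :
    metricTrace g (fun v w => B v w + C v w) = metricTrace g B + metricTrace g C := by
  simp [metricTrace, Finset.sum_add_distrib]

theorem metricTrace_smul {F : Type*} [AddCommGroup F] [Module ℝ F] (c : ℝ)
    (B : EuclideanSpace ℝ (Fin m) → EuclideanSpace ℝ (Fin m) → F) :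
    metricTrace g (fun v w => c • B v w) = c • metricTrace g B := by
  simp [metricTrace, Finset.smul_sum, smul_comm c]

theorem map_metricTrace {F F' : Type*} [AddCommGroup F] [Module ℝ F] [AddCommGroup F'] [Module ℝ F']
    (φ : F →ₗ[ℝ] F') (B : EuclideanSpace ℝ (Fin m) → EuclideanSpace ℝ (Fin m) → F) :
    φ (metricTrace g B) = metricTrace g (fun v w => φ (B v w)) := by
  simp [metricTrace]

variable {g}

theorem metricTrace_self (hsymm : ∀ v w, g v w = g w v) (hpos : ∀ v, v ≠ 0 → 0 < g v v) :
    metricTrace g (fun v w => g v w) = m := by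
  have hG := posDef_gram g hsymm hpos
  set G := Matrix.of fun k l => g (EuclideanSpace.basisFun (Fin m) ℝ k)
      (EuclideanSpace.basisFun (Fin m) ℝ l) with hGdef
  have h : (G⁻¹ * G).trace = m := by
    rw [Matrix.nonsing_inv_mul _ ((Matrix.isUnit_iff_isUnit_det _).mp hG.isUnit)]
    simp
  rw [← h]
  simp only [metricTrace, Matrix.trace, Matrix.diag_apply, Matrix.mul_apply, smul_eq_mul]
  refine Finset.sum_congr rfl fun k _ => Finset.sum_congr rfl fun l _ => ?_
  rw [hsymm]
  rfl

/-- The inverse Gram matrix is positive semidefinite, hence a sum of rank-one matrices `A_r A_rᵀ`.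
The trace thereby becomes `∑_r B(u_r, u_r)` with `u_r = ∑_k A_r(k) b_k`. -/
theorem metricTrace_nonneg (hsymm : ∀ v w, g v w = g w v) (hpos : ∀ v, v ≠ 0 → 0 < g v v)
    (B : EuclideanSpace ℝ (Fin m) →L[ℝ] EuclideanSpace ℝ (Fin m) →L[ℝ] ℝ)
    (hB : ∀ v, 0 ≤ B v v) : 0 ≤ metricTrace g (fun v w => B v w) := by
  obtain ⟨n, A, hA⟩ := Matrix.posSemidef_iff_eq_sum_vecMulVec.mp
    (posDef_gram g hsymm hpos).inv.posSemidef
  let b := EuclideanSpace.basisFun (Fin m) ℝ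
  have hA' : ∀ k l, (Matrix.of fun k l => g (b k) (b l))⁻¹ k l = ∑ r, A r k * A r l := fun k l => by
    simpa [Matrix.sum_apply, Matrix.vecMulVec_apply, b] using congrFun (congrFun hA k) l
  have hr : ∀ r, B (∑ k, A r k • b k) (∑ k, A r k • b k) =
      ∑ k, ∑ l, A r k * A r l * B (b k) (b l) := fun r => by
    simp only [map_sum, map_smul, sum_apply, smul_apply, smul_eq_mul, Finset.mul_sum]
    rw [Finset.sum_comm]
    refine Finset.sum_congr rfl fun k _ => Finset.sum_congr rfl fun l _ => ?_
    ring
  have key : metricTrace g (fun v w => B v w) =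
      ∑ r, B (∑ k, A r k • b k) (∑ k, A r k • b k) := by
    simp only [hr]
    change ∑ k, ∑ l, (Matrix.of fun k l => g (b k) (b l))⁻¹ k l • B (b k) (b l) = _
    simp only [hA', smul_eq_mul, Finset.sum_mul]
    rw [Finset.sum_comm]
    simp only [Finset.sum_comm (s := Finset.univ (α := Fin n))]
    rw [Finset.sum_comm]
  rw [key]
  exact Finset.sum_nonneg fun r _ => hB _

end Trace

/-! ### Metric components in the preferred chart -/

section Chart

variable {E : Type*} [NormedAddCommGroup E] [NormedSpace ℝ E]
  {H : Type*} [TopologicalSpace H] {I : ModelWithCorners ℝ E H} 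
  {X : Type*} [TopologicalSpace X] [ChartedSpace H X]

theorem metricInChart_apply (g : ∀ x : X, TangentSpace I x →L[ℝ] TangentSpace I x →L[ℝ] ℝ)
    (x₀ : X) (y v w : E) :
    metricInChart g x₀ y v w = g ((extChartAt I x₀).symm y)
      (mfderiv 𝓘(ℝ, E) I (extChartAt I x₀).symm y v)
      (mfderiv 𝓘(ℝ, E) I (extChartAt I x₀).symm y w) := rfl

variable [I.Boundaryless]

/-- The tangent space at `x₀` is identified with `E` through the preferred chart at `x₀` itself, so
that chart has identity differential there. -/
theorem mfderiv_extChartAt_symm_self [IsManifold I 1 X] (x₀ : X) (v : E) :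
    mfderiv 𝓘(ℝ, E) I (extChartAt I x₀).symm (extChartAt I x₀ x₀) v = v := by
  have h := mfderivWithin_range_extChartAt_symm (I := I) (x := x₀)
  rw [I.range_eq_univ, mfderivWithin_univ] at h
  rw [h]
  rfl

theorem metricInChart_self [IsManifold I 1 X]
    (g : ∀ x : X, TangentSpace I x →L[ℝ] TangentSpace I x →L[ℝ] ℝ) (x₀ : X) (v w : E) :
    metricInChart g x₀ (extChartAt I x₀ x₀) v w = g x₀ v w := by
  rw [metricInChart_apply]
  -- Every tangent space is `E` by definition; forgetting the dependence on the base point permits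
  -- rewriting it.
  let g' : X → E →L[ℝ] E →L[ℝ] ℝ := g
  have h1 : g' ((extChartAt I x₀).symm (extChartAt I x₀ x₀)) = g' x₀ := by
    rw [extChartAt_to_inv]
  change g' _ _ _ = g' x₀ v w
  rw [h1]
  congr 2
  · exact mfderiv_extChartAt_symm_self (I := I) x₀ v
  · exact mfderiv_extChartAt_symm_self (I := I) x₀ w

/-- These are the coordinate vector fields: the tangent map of the inverse chart applied to a
constant section. -/
theorem contMDiffOn_mfderiv_extChartAt_symm [IsManifold I ∞ X] (x₀ : X) (v : E) :
    ContMDiffOn 𝓘(ℝ, E) I.tangent ∞ (fun y => (⟨(extChartAt I x₀).symm y,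
      mfderiv 𝓘(ℝ, E) I (extChartAt I x₀).symm y v⟩ : TangentBundle I X))
      (extChartAt I x₀).target := by
  have hU : UniqueMDiffOn 𝓘(ℝ, E) (extChartAt I x₀).target :=
    (isOpen_extChartAt_target x₀).uniqueMDiffOn
  have h := (contMDiffOn_extChartAt_symm (I := I) (n := ∞) x₀).contMDiffOn_tangentMapWithin
    (m := ∞) (by simp) hU
  have hc : ContMDiff 𝓘(ℝ, E) 𝓘(ℝ, E).tangent ∞
      (fun y : E => (⟨y, v⟩ : TangentBundle 𝓘(ℝ, E) E)) :=
    contMDiff_vectorSpace_iff_contDiff.2 contDiff_const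
  refine (h.comp hc.contMDiffOn fun y hy => hy).congr fun y hy => ?_
  simp only [Function.comp, tangentMapWithin]
  rw [mfderivWithin_of_mem_nhds ((isOpen_extChartAt_target x₀).mem_nhds hy)]

/-- The components of a smooth metric are smooth. -/
theorem contDiffOn_metricInChart [FiniteDimensional ℝ E] [IsManifold I ∞ X]
    (g : Bundle.ContMDiffRiemannianMetric I ∞ E (fun x : X => TangentSpace I x)) (x₀ : X) :
    ContDiffOn ℝ ∞ (metricInChart g.inner x₀) (extChartAt I x₀).target := by
  refine contDiffOn_clm_apply.2 fun v => contDiffOn_clm_apply.2 fun w y hy => ?_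
  have hnhds : (extChartAt I x₀).target ∈ nhds y := (isOpen_extChartAt_target x₀).mem_nhds hy
  have hv := (contMDiffOn_mfderiv_extChartAt_symm (I := I) x₀ v).contMDiffAt hnhds
  have hw := (contMDiffOn_mfderiv_extChartAt_symm (I := I) x₀ w).contMDiffAt hnhds
  have hb := (contMDiffOn_extChartAt_symm (I := I) (n := ∞) x₀).contMDiffAt hnhds
  have : ContMDiffAt 𝓘(ℝ, E) (I.prod 𝓘(ℝ)) ∞
      (fun y ↦ Bundle.TotalSpace.mk' ℝ (E := Bundle.Trivial X ℝ) ((extChartAt I x₀).symm y)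
        (g.inner ((extChartAt I x₀).symm y) (mfderiv 𝓘(ℝ, E) I (extChartAt I x₀).symm y v)
          (mfderiv 𝓘(ℝ, E) I (extChartAt I x₀).symm y w))) y := by
    apply ContMDiffAt.clm_bundle_apply₂ (F₁ := E) (F₂ := E)
    · exact ContMDiffAt.comp y g.contMDiff.contMDiffAt hb
    · exact hv
    · exact hw
  simp only [Bundle.contMDiffAt_totalSpace] at this
  exact this.2.contDiffAt.contDiffWithinAt

end Chart

/-! ### The doubly warped metric and its Christoffel symbols -/

namespace DoublyWarpedProduct

variable {m : ℕ} {P : Type*} [TopologicalSpace P] [ChartedSpace (EuclideanSpace ℝ (Fin m)) P]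
  [IsManifold (𝓡 m) ∞ P] (W : DoublyWarpedProduct m P)

/-- The Riemannian metric of the fibre, as a bilinear form on the model space. -/
def spatialForm (x : P) :
    EuclideanSpace ℝ (Fin m) →L[ℝ] EuclideanSpace ℝ (Fin m) →L[ℝ] ℝ := W.σ.inner x

/-- The Lorentzian metric, as a bilinear form on the model space. -/
def form (p : ℝ × P) :
    ℝ × EuclideanSpace ℝ (Fin m) →L[ℝ] ℝ × EuclideanSpace ℝ (Fin m) →L[ℝ] ℝ := W.metric p

theorem form_apply (p : ℝ × P) (a b : ℝ × EuclideanSpace ℝ (Fin m)) :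
    W.form p a b = -(W.h p.2 ^ 2) * (a.1 * b.1) + W.ρ p.1 ^ 2 * W.spatialForm p.2 a.2 b.2 := by
  unfold form metric
  rw [mfderiv_fst, mfderiv_snd]
  rfl

theorem spatialForm_symm (x : P) (a b : EuclideanSpace ℝ (Fin m)) :
    W.spatialForm x a b = W.spatialForm x b a := W.σ.symm x a b

theorem spatialForm_pos (x : P) {a : EuclideanSpace ℝ (Fin m)} (ha : a ≠ 0) :
    0 < W.spatialForm x a a := W.σ.pos x a ha

theorem form_symm (p : ℝ × P) (a b : ℝ × EuclideanSpace ℝ (Fin m)) :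
    W.form p a b = W.form p b a := by
  rw [form_apply, form_apply, mul_comm a.1, W.spatialForm_symm p.2 a.2]

variable {W} in
-- A vector in the kernel is tested against `∂ₜ` and against its own spatial part; both warping
-- factors are nonzero.
theorem form_injective {p : ℝ × P} (hp : p.1 ∈ W.I) : Function.Injective (W.form p) := by
  rw [injective_iff_map_eq_zero]
  intro a ha
  have hh := (W.h_pos p.2).ne'
  have hρ := (W.ρ_pos _ hp).ne'
  have h1 : W.form p a (1, 0) = 0 := by rw [ha]; rfl
  have h2 : W.form p a (0, a.2) = 0 := by rw [ha]; rfl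
  rw [form_apply] at h1 h2
  have e1 : a.1 = 0 := by simpa [hh] using h1
  have e2 : a.2 = 0 := by
    by_contra hne
    have := W.spatialForm_pos p.2 hne
    simp [hρ, this.ne'] at h2
  exact Prod.ext e1 e2

/-- The chart at `p` is the product of the identity of `ℝ` and the chart of `P`, so its inverse has
block diagonal differential and the components stay free of mixed terms. -/
theorem metricInChart_metric (p : ℝ × P) {y : ℝ × EuclideanSpace ℝ (Fin m)}
    (hy : y.2 ∈ (extChartAt (𝓡 m) p.2).target) (a b : ℝ × EuclideanSpace ℝ (Fin m)) :
    metricInChart W.metric p y a b =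
      -(W.h ((extChartAt (𝓡 m) p.2).symm y.2) ^ 2) * (a.1 * b.1) +
        W.ρ y.1 ^ 2 * metricInChart W.σ.inner p.2 y.2 a.2 b.2 := by
  have hsymm : ((extChartAt (𝓘(ℝ, ℝ).prod (𝓡 m)) p).symm : ℝ × EuclideanSpace ℝ (Fin m) → ℝ × P) =
      Prod.map id (extChartAt (𝓡 m) p.2).symm := by
    rw [extChartAt_prod]
    rfl
  have hd : MDifferentiableAt (𝓡 m) (𝓡 m) (extChartAt (𝓡 m) p.2).symm y.2 :=
    ((contMDiffOn_extChartAt_symm (n := ∞) p.2).contMDiffAt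
      ((isOpen_extChartAt_target p.2).mem_nhds hy)).mdifferentiableAt (by simp)
  let D : EuclideanSpace ℝ (Fin m) →L[ℝ] EuclideanSpace ℝ (Fin m) :=
    mfderiv (𝓡 m) (𝓡 m) (extChartAt (𝓡 m) p.2).symm y.2
  let D' : ℝ × EuclideanSpace ℝ (Fin m) →L[ℝ] ℝ × EuclideanSpace ℝ (Fin m) :=
    mfderiv 𝓘(ℝ, ℝ × EuclideanSpace ℝ (Fin m)) (𝓘(ℝ, ℝ).prod (𝓡 m))
      (extChartAt (𝓘(ℝ, ℝ).prod (𝓡 m)) p).symm y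
  have hD : D' = (ContinuousLinearMap.fst ℝ ℝ (EuclideanSpace ℝ (Fin m))).prod
      (D.comp (ContinuousLinearMap.snd ℝ ℝ (EuclideanSpace ℝ (Fin m)))) := by
    have h1 : HasMFDerivAt 𝓘(ℝ, ℝ × EuclideanSpace ℝ (Fin m)) 𝓘(ℝ, ℝ)
        (Prod.fst : ℝ × EuclideanSpace ℝ (Fin m) → ℝ) y
        (ContinuousLinearMap.fst ℝ ℝ (EuclideanSpace ℝ (Fin m))) :=
      hasFDerivAt_fst.hasMFDerivAt
    have h2 : HasMFDerivAt 𝓘(ℝ, ℝ × EuclideanSpace ℝ (Fin m)) (𝓡 m)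
        (Prod.snd : ℝ × EuclideanSpace ℝ (Fin m) → EuclideanSpace ℝ (Fin m)) y
        (ContinuousLinearMap.snd ℝ ℝ (EuclideanSpace ℝ (Fin m))) :=
      hasFDerivAt_snd.hasMFDerivAt
    have h := (h1.prodMk (hd.hasMFDerivAt.comp y h2)).mfderiv
    unfold D'
    rw [hsymm]
    exact h
  have hbase : (extChartAt (𝓘(ℝ, ℝ).prod (𝓡 m)) p).symm y =
      (y.1, (extChartAt (𝓡 m) p.2).symm y.2) := congrFun hsymm y
  change W.form ((extChartAt (𝓘(ℝ, ℝ).prod (𝓡 m)) p).symm y) (D' a) (D' b) = _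
  rw [hbase, hD, form_apply]
  rfl

variable {W}

variable (W) in
-- Ensures that the `fderiv` in `christoffelLower` is a true derivative, which can be computed entry
-- by entry.
theorem contDiffOn_metricInChart_metric (p : ℝ × P) :
    ContDiffOn ℝ ∞ (metricInChart W.metric p) (W.I ×ˢ (extChartAt (𝓡 m) p.2).target) := by
  refine contDiffOn_clm_apply.2 fun v => contDiffOn_clm_apply.2 fun w => ?_
  refine ContDiffOn.congr ?_ fun y hy => W.metricInChart_metric p hy.2 v w
  have hS : ContDiffOn ℝ ∞ (fun z => metricInChart W.σ.inner p.2 z v.2 w.2)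
      (extChartAt (𝓡 m) p.2).target :=
    contDiffOn_clm_apply.1 (contDiffOn_clm_apply.1 (contDiffOn_metricInChart W.σ p.2) v.2) w.2
  have hh : ContDiffOn ℝ ∞ (fun z => W.h ((extChartAt (𝓡 m) p.2).symm z))
      (extChartAt (𝓡 m) p.2).target :=
    (W.contMDiff_h.comp_contMDiffOn (contMDiffOn_extChartAt_symm (I := 𝓡 m) p.2)).contDiffOn
  have hh' := hh.comp (t := (extChartAt (𝓡 m) p.2).target)
    (s := W.I ×ˢ (extChartAt (𝓡 m) p.2).target) contDiffOn_snd fun y hy => hy.2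
  have hρ' := W.contDiffOn_ρ.comp (s := W.I ×ˢ (extChartAt (𝓡 m) p.2).target)
    contDiffOn_fst fun y hy => hy.1
  have hS' := hS.comp (s := W.I ×ˢ (extChartAt (𝓡 m) p.2).target)
    contDiffOn_snd fun y hy => hy.2
  exact ((hh'.pow 2).neg.mul contDiffOn_const).add ((hρ'.pow 2).mul hS')

/-- The time component of `∇_∂ₐ ∂_b` for spatial coordinate fields. -/
theorem form_christoffel_time {p : ℝ × P} (hp : p.1 ∈ W.I)
    {a b : ℝ × EuclideanSpace ℝ (Fin m)} (ha : a.1 = 0) (hb : b.1 = 0) :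
    W.form p (christoffel W.metric p a b) (1, 0) =
      -(W.ρ p.1 * deriv W.ρ p.1 * W.spatialForm p.2 a.2 b.2) := by
  set y₀ := extChartAt (𝓘(ℝ, ℝ).prod (𝓡 m)) p p with hy₀
  have hy₀' : y₀ = (p.1, extChartAt (𝓡 m) p.2 p.2) := by
    rw [hy₀, extChartAt_prod]
    rfl
  let G : ℝ × EuclideanSpace ℝ (Fin m) →
    ℝ × EuclideanSpace ℝ (Fin m) →L[ℝ] ℝ × EuclideanSpace ℝ (Fin m) →L[ℝ] ℝ :=
      metricInChart W.metric p
  have hself : G y₀ = W.form p := by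
    refine ContinuousLinearMap.ext fun v => ContinuousLinearMap.ext fun w => ?_
    exact metricInChart_self (I := 𝓘(ℝ, ℝ).prod (𝓡 m)) W.metric p v w
  have hev : ∀ᶠ y in nhds y₀, ∀ v w, G y v w =
      -(W.h ((extChartAt (𝓡 m) p.2).symm y.2) ^ 2) * (v.1 * w.1) +
        W.ρ y.1 ^ 2 * metricInChart W.σ.inner p.2 y.2 v.2 w.2 := by
    have : ∀ᶠ y in nhds y₀, y.2 ∈ (extChartAt (𝓡 m) p.2).target :=
      continuous_snd.continuousAt.eventually_mem (by
        rw [hy₀']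
        exact extChartAt_target_mem_nhds (I := 𝓡 m) p.2)
    filter_upwards [this] with y hy v w
    exact W.metricInChart_metric p hy v w
  have hρ : DifferentiableAt ℝ W.ρ y₀.1 := by
    rw [hy₀']
    exact (W.contDiffOn_ρ.contDiffAt (W.isOpen_I.mem_nhds hp)).differentiableAt (by simp)
  have hG : DifferentiableAt ℝ G y₀ := by
    refine ((contDiffOn_metricInChart_metric W p).contDiffAt (n := ∞) ?_).differentiableAt (by simp)
    rw [hy₀']
    exact prod_mem_nhds (W.isOpen_I.mem_nhds hp) (extChartAt_target_mem_nhds (I := 𝓡 m) p.2)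
  have hdG : ∀ z v w, fderiv ℝ G y₀ z v w = fderiv ℝ (fun y => G y v w) y₀ z := fun z v w => by
    have := ((hG.hasFDerivAt.clm_apply (hasFDerivAt_const v y₀)).clm_apply (hasFDerivAt_const w y₀))
    rw [this.fderiv]
    simp
  -- Mixed components vanish throughout a neighbourhood, so their derivatives vanish too. Thus the
  -- variation of `h` plays no role here.
  have hzero : ∀ z v : ℝ × EuclideanSpace ℝ (Fin m), v.1 = 0 →
      fderiv ℝ G y₀ z v (1, 0) = 0 := fun z v hv => by
    have : (fun y => G y v (1, 0)) =ᶠ[nhds y₀] fun _ => 0 := by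
      filter_upwards [hev] with y hy
      rw [hy, hv]
      simp
    rw [hdG, this.fderiv_eq]
    simp
  have hS₀ : metricInChart W.σ.inner p.2 y₀.2 a.2 b.2 = W.spatialForm p.2 a.2 b.2 := by
    rw [hy₀']
    exact metricInChart_self (I := 𝓡 m) W.σ.inner p.2 a.2 b.2
  have htime : fderiv ℝ G y₀ (1, 0) a b =
      2 * W.ρ p.1 * deriv W.ρ p.1 * W.spatialForm p.2 a.2 b.2 := by
    -- Along the time line through `y₀` the spatial components are `ρ(t)²` times a constant.
    have hγ : HasDerivAt (fun t => (t, y₀.2)) ((1, 0) : ℝ × EuclideanSpace ℝ (Fin m)) y₀.1 :=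
      (hasDerivAt_id _).prodMk (hasDerivAt_const _ _)
    have hGab : DifferentiableAt ℝ (fun y => G y a b) y₀ :=
      (hG.clm_apply (differentiableAt_const a)).clm_apply (differentiableAt_const b)
    have h1 : HasDerivAt (fun t => G (t, y₀.2) a b) (fderiv ℝ G y₀ (1, 0) a b) y₀.1 := by
      rw [hdG]
      exact hGab.hasFDerivAt.comp_hasDerivAt (f := fun t => (t, y₀.2)) y₀.1 hγ
    have h2 : (fun t => G (t, y₀.2) a b) =ᶠ[nhds y₀.1]
        fun t => W.ρ t ^ 2 * W.spatialForm p.2 a.2 b.2 := by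
      have hc : Filter.Tendsto (fun t => (t, y₀.2)) (nhds y₀.1) (nhds y₀) := hγ.continuousAt
      filter_upwards [hc.eventually hev] with t ht
      rw [ht, ha, hS₀]
      simp
    have h3 := ((hρ.hasDerivAt.fun_pow 2).mul_const (W.spatialForm p.2 a.2 b.2)).congr_of_eventuallyEq
      h2
    rw [h1.unique h3]
    simp [hy₀']
  have hlower : christoffelLower W.metric p a b (1, 0) =
      -(W.ρ p.1 * deriv W.ρ p.1 * W.spatialForm p.2 a.2 b.2) := by
    change (1 / 2 : ℝ) * (fderiv ℝ G y₀ a b (1, 0) + fderiv ℝ G y₀ b a (1, 0) -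
      fderiv ℝ G y₀ (1, 0) a b) = _
    rw [hzero a b hb, hzero b a ha, htime]
    ring
  -- Nondegeneracy of the metric makes `christoffel` represent `christoffelLower`.
  rw [← hlower, ← hself]
  exact congrArg (fun l : ℝ × EuclideanSpace ℝ (Fin m) →L[ℝ] ℝ => l (1, 0))
    ((G y₀).apply_inverse_of_injective (hself ▸ form_injective hp) (christoffelLower W.metric p a b))

end DoublyWarpedProduct

/-! ### The height function and the mean curvature at its critical points -/

theorem ContinuousLinearMap.fderiv_fderiv_comp {E F F' : Type*} [NormedAddCommGroup E]
    [NormedSpace ℝ E] [NormedAddCommGroup F] [NormedSpace ℝ F] [NormedAddCommGroup F']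
    [NormedSpace ℝ F'] (L : F →L[ℝ] F') {f : E → F} {x : E} (hf : ContDiffAt ℝ 2 f x) (v w : E) :
    fderiv ℝ (fderiv ℝ (L ∘ f)) x v w = L (fderiv ℝ (fderiv ℝ f) x v w) := by
  have h := congrArg (fun T => T ![v, w])
    (L.iteratedFDeriv_comp_left (i := 2) hf (by norm_num))
  simpa [iteratedFDeriv_two_apply] using h

namespace DoublyWarpedProduct

section Height

variable {m : ℕ} {P : Type*} {M : Type*} [TopologicalSpace M]
  [ChartedSpace (EuclideanSpace ℝ (Fin m)) M]

/-- The height function of `ψ` in the preferred chart at `q`. -/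
def heightInChart (ψ : M → ℝ × P) (q : M) (y : EuclideanSpace ℝ (Fin m)) : ℝ :=
  (ψ ((extChartAt (𝓡 m) q).symm y)).1

theorem tendsto_extChartAt_symm (q : M) : Filter.Tendsto (extChartAt (𝓡 m) q).symm
    (nhds (extChartAt (𝓡 m) q q)) (nhds q) := by
  simpa using (continuousAt_extChartAt_symm (I := 𝓡 m) q).tendsto

theorem isLocalMin_heightInChart {ψ : M → ℝ × P} {q : M}
    (h : IsLocalMin (fun q => (ψ q).1) q) :
    IsLocalMin (heightInChart (m := m) ψ q) (extChartAt (𝓡 m) q q) := by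
  have := (tendsto_extChartAt_symm (m := m) q).eventually h
  simpa [IsLocalMin, IsMinFilter, heightInChart] using this

theorem isLocalMax_heightInChart {ψ : M → ℝ × P} {q : M}
    (h : IsLocalMax (fun q => (ψ q).1) q) :
    IsLocalMax (heightInChart (m := m) ψ q) (extChartAt (𝓡 m) q q) := by
  have := (tendsto_extChartAt_symm (m := m) q).eventually h
  simpa [IsLocalMax, IsMaxFilter, heightInChart] using this

end Height

variable {m : ℕ} {P : Type*} [TopologicalSpace P] [ChartedSpace (EuclideanSpace ℝ (Fin m)) P]
  {M : Type*} [TopologicalSpace M] [ChartedSpace (EuclideanSpace ℝ (Fin m)) M]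

/-- The product chart leaves time unchanged, so derivatives of the height are time components of
derivatives of `ψ` in charts. -/
theorem heightInChart_eq (ψ : M → ℝ × P) (q : M) :
    heightInChart ψ q = ContinuousLinearMap.fst ℝ ℝ (EuclideanSpace ℝ (Fin m)) ∘
      writtenInExtChartAt (𝓡 m) (𝓘(ℝ, ℝ).prod (𝓡 m)) q ψ := by
  ext y
  simp only [writtenInExtChartAt, extChartAt_prod]
  rfl

variable [IsManifold (𝓡 m) ∞ P] {W : DoublyWarpedProduct m P}

/-- The differential of `ψ` at `q`, as a map of model spaces. -/
def modelDifferential (ψ : M → ℝ × P) (q : M) :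
    EuclideanSpace ℝ (Fin m) →L[ℝ] ℝ × EuclideanSpace ℝ (Fin m) :=
  mfderiv (𝓡 m) (𝓘(ℝ, ℝ).prod (𝓡 m)) ψ q

/-- The induced metric at `q`, as a bilinear form on the model space. -/
def inducedForm (W : DoublyWarpedProduct m P) (ψ : M → ℝ × P) (q : M) :
    EuclideanSpace ℝ (Fin m) →L[ℝ] EuclideanSpace ℝ (Fin m) →L[ℝ] ℝ :=
  pullbackMetric (𝓡 m) W.metric ψ q

theorem inducedForm_apply (ψ : M → ℝ × P) (q : M) (v w : EuclideanSpace ℝ (Fin m)) :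
    W.inducedForm ψ q v w =
      W.form (ψ q) (modelDifferential ψ q v) (modelDifferential ψ q w) := rfl

theorem inducedForm_symm (ψ : M → ℝ × P) (q : M) (v w : EuclideanSpace ℝ (Fin m)) :
    W.inducedForm ψ q v w = W.inducedForm ψ q w v :=
  W.form_symm _ _ _

namespace IsSpacelikeHypersurface

variable {ψ : M → ℝ × P}

theorem inducedForm_pos (hψ : W.IsSpacelikeHypersurface ψ) (q : M)
    {v : EuclideanSpace ℝ (Fin m)} (hv : v ≠ 0) : 0 < W.inducedForm ψ q v v :=
  hψ.posDef q v hv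

/-- At a critical point of the height function the unit normal is `h⁻¹ ∂ₜ`. -/
theorem normal_eq (hψ : W.IsSpacelikeHypersurface ψ)
    {N : ∀ q : M, TangentSpace (𝓘(ℝ, ℝ).prod (𝓡 m)) (ψ q)} (hN : W.IsFutureUnitNormal ψ N) {q : M}
    (hq : ∀ v : EuclideanSpace ℝ (Fin m), (modelDifferential ψ q v).1 = 0) :
    (N q : ℝ × EuclideanSpace ℝ (Fin m)) = ((W.h (ψ q).2)⁻¹, 0) := by
  obtain ⟨n, hn⟩ : ∃ n : ℝ × EuclideanSpace ℝ (Fin m), n = N q := ⟨_, rfl⟩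
  have hunit : W.form (ψ q) n n = -1 := by rw [hn]; exact hN.unit q
  have hnormal : ∀ v : EuclideanSpace ℝ (Fin m), W.form (ψ q) n (modelDifferential ψ q v) = 0 := fun v => by
    rw [hn]; exact hN.normal q v
  have hfuture : W.form (ψ q) n (1, 0) < 0 := by rw [hn]; exact hN.future q
  have hh := W.h_pos (ψ q).2
  have hρ := W.ρ_pos _ (hψ.mem_I q)
  -- `A` is the spatial part of `dψ`. Injective between spaces of equal dimension, it is onto, so
  -- some tangent vector of `M` has the spatial part of `n` as its image; orthogonality to it forces
  -- that part to vanish.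
  let A : EuclideanSpace ℝ (Fin m) →ₗ[ℝ] EuclideanSpace ℝ (Fin m) :=
    LinearMap.snd ℝ ℝ _ ∘ₗ (modelDifferential ψ q).toLinearMap
  have hA : Function.Injective A := by
    rw [injective_iff_map_eq_zero]
    intro v hv
    by_contra hne
    have hpos := hψ.inducedForm_pos q hne
    have h0 : modelDifferential ψ q v = 0 := Prod.ext (hq v) hv
    rw [inducedForm_apply, h0] at hpos
    simp at hpos
  have hn2 : n.2 = 0 := by
    obtain ⟨v, hv⟩ := LinearMap.injective_iff_surjective.1 hA n.2
    have hv' : (modelDifferential ψ q v).2 = n.2 := hv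
    have h := hnormal v
    rw [form_apply, hq, hv'] at h
    by_contra hne
    have := W.spatialForm_pos (ψ q).2 hne
    simp [hρ.ne', this.ne'] at h
  rw [form_apply, hn2] at hunit hfuture
  -- The future condition selects the positive root of `(h n.1)² = 1`.
  have hn1 : 0 < n.1 := by
    have : 0 < W.h (ψ q).2 ^ 2 * n.1 := by simpa using hfuture
    exact pos_of_mul_pos_right this (by positivity)
  have h1 : W.h (ψ q).2 * n.1 = 1 := by
    have h2 : (W.h (ψ q).2 * n.1) ^ 2 = 1 := by
      simp only [map_zero, mul_zero, add_zero] at hunit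
      linarith
    exact (pow_eq_one_iff_of_nonneg (by positivity) (by norm_num)).1 h2
  rw [← hn]
  exact Prod.ext (eq_inv_of_mul_eq_one_right h1) hn2

theorem contDiffAt_writtenInExtChartAt (hψ : W.IsSpacelikeHypersurface ψ) (q : M) :
    ContDiffAt ℝ ∞ (writtenInExtChartAt (𝓡 m) (𝓘(ℝ, ℝ).prod (𝓡 m)) q ψ)
      (extChartAt (𝓡 m) q q) := by
  have h := (contMDiffAt_iff.1 (hψ.contMDiff.contMDiffAt (x := q))).2
  rw [(𝓡 m).range_eq_univ] at h
  exact h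

theorem contDiffAt_heightInChart (hψ : W.IsSpacelikeHypersurface ψ) (q : M) :
    ContDiffAt ℝ ∞ (heightInChart ψ q) (extChartAt (𝓡 m) q q) := by
  rw [heightInChart_eq]
  exact contDiffAt_fst.comp _ (hψ.contDiffAt_writtenInExtChartAt q)

theorem modelDifferential_fst (hψ : W.IsSpacelikeHypersurface ψ) (q : M)
    (v : EuclideanSpace ℝ (Fin m)) :
    (modelDifferential ψ q v).1 = fderiv ℝ (heightInChart ψ q) (extChartAt (𝓡 m) q q) v := by
  have hd : MDifferentiableAt (𝓡 m) (𝓘(ℝ, ℝ).prod (𝓡 m)) ψ q :=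
    hψ.contMDiff.mdifferentiableAt (by simp)
  have h : modelDifferential ψ q =
      fderiv ℝ (writtenInExtChartAt (𝓡 m) (𝓘(ℝ, ℝ).prod (𝓡 m)) q ψ) (extChartAt (𝓡 m) q q) := by
    unfold modelDifferential
    rw [hd.mfderiv, (𝓡 m).range_eq_univ, fderivWithin_univ]
  rw [h, heightInChart_eq, ((ContinuousLinearMap.fst ℝ ℝ (EuclideanSpace ℝ (Fin m))).hasFDerivAt.comp _
    ((hψ.contDiffAt_writtenInExtChartAt q).differentiableAt (by simp)).hasFDerivAt).fderiv]
  rfl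

/-- The mean curvature at a critical point of the height function. -/
theorem meanCurvature_eq (hm : 1 ≤ m) (hψ : W.IsSpacelikeHypersurface ψ)
    {N : ∀ q : M, TangentSpace (𝓘(ℝ, ℝ).prod (𝓡 m)) (ψ q)} (hN : W.IsFutureUnitNormal ψ N) {q : M}
    (hq : fderiv ℝ (heightInChart ψ q) (extChartAt (𝓡 m) q q) = 0) :
    meanCurvature m W.metric ψ N q = W.sliceCurvature (ψ q) + W.h (ψ q).2 / m *
      metricTrace (W.inducedForm ψ q) (fun v w =>
        fderiv ℝ (fderiv ℝ (heightInChart ψ q)) (extChartAt (𝓡 m) q q) v w) := by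
  have hq' : ∀ v : EuclideanSpace ℝ (Fin m), (modelDifferential ψ q v).1 = 0 := fun v => by
    rw [hψ.modelDifferential_fst, hq]; rfl
  have hm' : (m : ℝ) ≠ 0 := by positivity
  have hh := W.h_pos (ψ q).2
  have hρ := W.ρ_pos _ (hψ.mem_I q)
  let II : EuclideanSpace ℝ (Fin m) → EuclideanSpace ℝ (Fin m) → ℝ × EuclideanSpace ℝ (Fin m) :=
    secondFundamentalForm (I := 𝓡 m) W.metric ψ q
  let n : ℝ × EuclideanSpace ℝ (Fin m) := N q
  have hn : n = ((W.h (ψ q).2)⁻¹, 0) := hψ.normal_eq hN hq'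
  -- `φ = -g(·, N)`; by linearity it passes through the trace defining the mean curvature vector.
  let φ : ℝ × EuclideanSpace ℝ (Fin m) →L[ℝ] ℝ := -(W.form (ψ q)).flip n
  have hnormal : ∀ v : EuclideanSpace ℝ (Fin m), W.form (ψ q) (modelDifferential ψ q v) n = 0 := fun v => by
    rw [form_symm]; exact hN.normal q v
  have hφn : ∀ u, φ u = -(W.form (ψ q) u n) := fun _ => rfl
  have hφ : ∀ u, φ u = -((W.h (ψ q).2)⁻¹ * W.form (ψ q) u (1, 0)) := fun u => by
    have hn' : n = (W.h (ψ q).2)⁻¹ • ((1, 0) : ℝ × EuclideanSpace ℝ (Fin m)) := by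
      rw [hn]; simp
    rw [hφn, hn', map_smul, smul_eq_mul]
  -- The term `D` yields the Hessian of the height, `c` yields `ρ ρ' σ / h = 𝓗 ρ² σ`, and the
  -- tangential term is killed by the normal.
  have hII : ∀ v w, φ (II v w) = W.h (ψ q).2 *
      fderiv ℝ (fderiv ℝ (heightInChart ψ q)) (extChartAt (𝓡 m) q q) v w +
        W.sliceCurvature (ψ q) * W.inducedForm ψ q v w := fun v w => by
    set D : ℝ × EuclideanSpace ℝ (Fin m) := fderiv ℝ (fderiv ℝ
      (writtenInExtChartAt (𝓡 m) (𝓘(ℝ, ℝ).prod (𝓡 m)) q ψ)) (extChartAt (𝓡 m) q q) v w with hD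
    have hDfst : fderiv ℝ (fderiv ℝ (heightInChart ψ q)) (extChartAt (𝓡 m) q q) v w = D.1 := by
      rw [heightInChart_eq, ContinuousLinearMap.fderiv_fderiv_comp _
        ((hψ.contDiffAt_writtenInExtChartAt q).of_le (by norm_cast))]
      rfl
    obtain ⟨c, hc⟩ : ∃ c : ℝ × EuclideanSpace ℝ (Fin m), c = christoffel W.metric (ψ q)
      (modelDifferential ψ q v) (modelDifferential ψ q w) := ⟨_, rfl⟩
    obtain ⟨c', hc'⟩ : ∃ c' : EuclideanSpace ℝ (Fin m),
      c' = christoffel (pullbackMetric (𝓡 m) W.metric ψ) q v w := ⟨_, rfl⟩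
    have hsplit : II v w = (D + c) - modelDifferential ψ q c' := by
      rw [hc, hc']
      rfl
    have h1 : φ (modelDifferential ψ q c') = 0 := by
      rw [hφn, hnormal, neg_zero]
    have h2 : W.form (ψ q) c (1, 0) = -(W.ρ (ψ q).1 * deriv W.ρ (ψ q).1 *
        W.spatialForm (ψ q).2 (modelDifferential ψ q v).2 (modelDifferential ψ q w).2) := by
      rw [hc]
      exact form_christoffel_time (hψ.mem_I q) (hq' v) (hq' w)
    rw [hsplit, map_sub, map_add, h1, hφ, hφ, h2, hDfst, form_apply, inducedForm_apply, form_apply,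
      hq', hq', sliceCurvature]
    simp only [mul_one, map_zero, mul_zero, add_zero, zero_add, sub_zero]
    field_simp
  have hH : meanCurvature m W.metric ψ N q =
      φ ((1 / m : ℝ) • metricTrace (W.inducedForm ψ q) II) := rfl
  rw [hH, map_smul]
  have htr := map_metricTrace (W.inducedForm ψ q) φ.toLinearMap II
  rw [ContinuousLinearMap.coe_coe] at htr
  simp only [hII] at htr
  rw [htr, metricTrace_add]
  have e1 := metricTrace_smul (W.inducedForm ψ q) (W.h (ψ q).2) (fun v w =>
    fderiv ℝ (fderiv ℝ (heightInChart ψ q)) (extChartAt (𝓡 m) q q) v w)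
  have e2 := metricTrace_smul (W.inducedForm ψ q) (W.sliceCurvature (ψ q)) (fun v w =>
    W.inducedForm ψ q v w)
  simp only [smul_eq_mul] at e1 e2
  rw [e1, e2, metricTrace_self (inducedForm_symm ψ q) fun v hv => hψ.inducedForm_pos q hv]
  simp only [smul_eq_mul]
  field_simp
  ring

end IsSpacelikeHypersurface

end DoublyWarpedProduct

end

/-! ### The comparison at local extrema of the height -/

open DoublyWarpedProduct

theorem theorem3p5 {m : ℕ} (hm : 1 ≤ m)
    {P : Type*} [TopologicalSpace P] [ChartedSpace (EuclideanSpace ℝ (Fin m)) P]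
    [IsManifold (𝓡 m) ∞ P] (W : DoublyWarpedProduct m P)
    {M : Type*} [TopologicalSpace M] [ChartedSpace (EuclideanSpace ℝ (Fin m)) M]
    [IsManifold (𝓡 m) ∞ M]
    (ψ : M → ℝ × P) (hψ : W.IsSpacelikeHypersurface ψ)
    (N : ∀ q : M, TangentSpace (𝓘(ℝ, ℝ).prod (𝓡 m)) (ψ q)) (hN : W.IsFutureUnitNormal ψ N) :
    (∀ p₀ : M, IsLocalMin (fun q => (ψ q).1) p₀ →
      W.sliceCurvature (ψ p₀) ≤ meanCurvature m W.metric ψ N p₀) ∧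
    (∀ p₁ : M, IsLocalMax (fun q => (ψ q).1) p₁ →
      W.sliceCurvature (ψ p₁) ≥ meanCurvature m W.metric ψ N p₁) := by
  have h2 : ∀ q : M, ContDiffAt ℝ 2 (heightInChart ψ q) (extChartAt (𝓡 m) q q) := fun q =>
    (hψ.contDiffAt_heightInChart q).of_le (by norm_cast)
  have hc : ∀ q : M, 0 ≤ W.h (ψ q).2 / m := fun q => div_nonneg (W.h_pos _).le (Nat.cast_nonneg _)
  refine ⟨fun q hq => ?_, fun q hq => ?_⟩
  · have hmin := isLocalMin_heightInChart (m := m) hq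
    rw [hψ.meanCurvature_eq hm hN hmin.fderiv_eq_zero]
    exact le_add_of_nonneg_right (mul_nonneg (hc q) (metricTrace_nonneg (inducedForm_symm ψ q)
      (fun v hv => hψ.inducedForm_pos q hv) _ (hmin.fderiv_fderiv_nonneg (h2 q))))
  · have hmax := isLocalMax_heightInChart (m := m) hq
    rw [hψ.meanCurvature_eq hm hN hmax.fderiv_eq_zero]
    -- At a maximum the nonnegative form is minus the Hessian; the sign is then pulled out of the
    -- trace.
    have h := metricTrace_nonneg (inducedForm_symm ψ q) (fun v hv => hψ.inducedForm_pos q hv)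
      (-fderiv ℝ (fderiv ℝ (heightInChart ψ q)) (extChartAt (𝓡 m) q q))
      (fun v => neg_nonneg.2 (hmax.fderiv_fderiv_nonpos (h2 q) v))
    have e := metricTrace_smul (W.inducedForm ψ q) (-1) (fun v w =>
      fderiv ℝ (fderiv ℝ (heightInChart ψ q)) (extChartAt (𝓡 m) q q) v w)
    simp only [neg_smul, one_smul] at e
    have h' : metricTrace (W.inducedForm ψ q) (fun v w =>
      fderiv ℝ (fderiv ℝ (heightInChart ψ q)) (extChartAt (𝓡 m) q q) v w) ≤ 0 :=
      neg_nonneg.1 (e ▸ h)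
    exact add_le_of_nonpos_right (mul_nonpos_of_nonneg_of_nonpos (hc q) h')
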